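/- Let $(V,E,c)$ be a connected network: $V$ is a countable set, $E\subset V\times V$ is a symmetric relation without loops such that every $x\in V$ has finitely many, and at least one, neighbours $y\sim x$ (i.e. $(x,y)\in E$), the graph is connected, and $c_{xy}=c_{yx}>0$ for $(x,y)\in E$. Let $\mathscr H_E$ be the Hilbert space of functions $u:V\to\mathbb C$, modulo constants, with finite energy $\|u\|_{\mathscr H_E}^2=\frac12\sum_{(x,y)\in E}c_{xy}|u(x)-u(y)|^2<\infty$, with inner product $\langle u,v\rangle_{\mathscr H_E}=\frac12\sum_{(x,y)\in E}c_{xy}\overline{(u(x)-u(y))}(v(x)-v(y))$, and let $(\Delta u)(x)=\sum_{y\sim x}c_{xy}(u(x)-u(y))$. Fix $o\in V$, put $V'=V\setminus\{o\}$, let $v_x\in\mathscr H_E$ ($x\in V'$) be the dipole determined by $\langle v_x,u\rangle_{\mathscr H_E}=u(x)-u(o)$ for all $u\in\mathscr H_E$, and let $\mathscr D_E$ be the space of finite linear combinations of the $v_x$, $x\in V'$. The operator $\Delta$ with domain $\mathscr D_E$ is densely defined, symmetric and nonnegative in $\mathscr H_E$; let $\Delta_{Fri}$ be its Friedrichs extension,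 i.e. the operator associated with the closure of the quadratic form $\varphi\mapsto\langle\varphi,\Delta\varphi\rangle_{\mathscr H_E}$ on $\mathscr D_E$. A function $u:V\to\mathbb C$ is in the domain of $\Delta_{Fri}$ (that is, it has finite energy and its class in $\mathscr H_E$ lies in that domain) if and only if the following two conditions hold: 1. $u$ is in the completion of $\mathscr D_E$ with respect to the quadratic form $\varphi\mapsto\langle\varphi,\Delta\varphi\rangle_{\mathscr H_E}$, taken inside $\mathscr H_E$: $u$ has finite energy and there are $\varphi_n\in\mathscr D_E$ with $\varphi_n\to u$ in $\mathscr H_E$ and $\langle\varphi_n-\varphi_m,\Delta(\varphi_n-\varphi_m)\rangle_{\mathscr H_E}\to0$ as $n,m\to\infty$; 2. $\Delta u\in\mathscr H_E$, i.e. the function $\Delta u$ has finite energy. Moreover, for every finite sum $\varphi=\sum_{x\in V'}\xi_xv_x$ one has $\langle\varphi,\Delta\varphi\rangle_{\mathscr H_E}=\sum_{x\in V'}|\xi_x|^2+\bigl|\sum_{x\in V'}\xi_x\bigr|^2$; in particular $\langle\varphi,\Delta\varphi\rangle_{\mathscr H_E}=\sum_{x\in V'}|\xi_x|^2$ when $\sum_{x\in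 V'}\xi_x=0$. -/

import Mathlib

open Filter Topology

noncomputable section

/-! ### The Friedrichs extension of a nonnegative symmetric operator -/

section Friedrichs

variable {H : Type*} [NormedAddCommGroup H] [InnerProductSpace ℂ H]

/-- `S` is densely defined, symmetric and nonnegative. -/
structure IsNonnegSymmetric (S : H →ₗ.[ℂ] H) : Prop where
  dense : Dense (S.domain : Set H)
  symm : ∀ φ ψ : S.domain, inner ℂ (S φ) (ψ : H) = inner ℂ (φ : H) (S ψ)
  nonneg : ∀ φ : S.domain, 0 ≤ (inner ℂ (φ : H) (S φ)).re

/-- The sequence `φ_n` in the domain of `S` converges to `u` in `H` and is a Cauchy sequence for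
the quadratic form `φ ↦ ⟨φ, Sφ⟩`. -/
def FormConverges (S : H →ₗ.[ℂ] H) (φ : ℕ → S.domain) (u : H) : Prop :=
  Tendsto (fun n => (φ n : H)) atTop (𝓝 u) ∧
    Tendsto (fun p : ℕ × ℕ =>
      (inner ℂ ((φ p.1 - φ p.2 : S.domain) : H) (S (φ p.1 - φ p.2))).re) atTop (𝓝 0)

/-- The completion, inside `H`, of the domain of `S` with respect to the quadratic form
`φ ↦ ⟨φ, Sφ⟩` (together with the norm of `H`): the domain of the closure of the form. -/
def formDomain (S : H →ₗ.[ℂ] H) : Set H :=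
  {u | ∃ φ : ℕ → S.domain, FormConverges S φ u}

theorem FormConverges.const (S : H →ₗ.[ℂ] H) (φ : S.domain) :
    FormConverges S (fun _ => φ) (φ : H) := by
  refine ⟨tendsto_const_nhds, ?_⟩
  simp

theorem FormConverges.smul {S : H →ₗ.[ℂ] H} {φ : ℕ → S.domain} {u : H}
    (h : FormConverges S φ u) (a : ℂ) : FormConverges S (fun n => a • φ n) (a • u) := by
  refine ⟨h.1.const_smul a, ?_⟩
  have := h.2.const_mul (‖a‖ ^ 2)
  rw [mul_zero] at this
  refine this.congr fun p => ?_
  rw [← smul_sub, LinearPMap.map_smul, Submodule.coe_smul, inner_smul_left, inner_smul_right,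
    ← mul_assoc, Complex.conj_mul', ← Complex.ofReal_pow, Complex.re_ofReal_mul]

theorem FormConverges.add {S : H →ₗ.[ℂ] H} (hS : IsNonnegSymmetric S) {φ ψ : ℕ → S.domain}
    {u v : H} (hu : FormConverges S φ u) (hv : FormConverges S ψ v) :
    FormConverges S (fun n => φ n + ψ n) (u + v) := by
  refine ⟨hu.1.add hv.1, ?_⟩
  have h2 := (hu.2.add hv.2).const_mul 2
  rw [add_zero, mul_zero] at h2
  refine squeeze_zero (fun p => hS.nonneg _) (fun p => ?_) h2
  have key : ∀ a b : S.domain, (inner ℂ ((a + b : S.domain) : H) (S (a + b))).re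
      ≤ 2 * ((inner ℂ (a : H) (S a)).re + (inner ℂ (b : H) (S b)).re) := by
    intro a b
    have h := hS.nonneg (a - b)
    simp only [LinearPMap.map_sub, LinearPMap.map_add, Submodule.coe_sub, Submodule.coe_add,
      inner_sub_left, inner_sub_right, inner_add_left, inner_add_right, Complex.add_re,
      Complex.sub_re] at h ⊢
    linarith
  rw [show φ p.1 + ψ p.1 - (φ p.2 + ψ p.2) = (φ p.1 - φ p.2) + (ψ p.1 - ψ p.2) by abel]
  exact key _ _

/-- The graph of the operator associated with the closure `q` of the form `⟨φ, Sψ⟩`: the pairs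
`(u, w)` such that `u` is in the domain of `q` and `q(u, v) = ⟨w, v⟩` for all `v` in the domain
of `q`, where `q(u, v)` is the limit of `⟨φ_n, Sψ_n⟩` along sequences `φ_n` and `ψ_n` that converge
to `u` and `v` in the sense of the form. -/
def friedrichsGraph (S : H →ₗ.[ℂ] H) (hS : IsNonnegSymmetric S) : Submodule ℂ (H × H) where
  carrier := {p | ∃ φ, FormConverges S φ p.1 ∧ ∀ v ψ, FormConverges S ψ v →
    Tendsto (fun n => inner ℂ (φ n : H) (S (ψ n))) atTop (𝓝 (inner ℂ p.2 v))}
  zero_mem' := ⟨fun _ => 0, FormConverges.const S 0, fun v ψ _ => by simp⟩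
  add_mem' := by
    rintro p r ⟨φ, hφ, hp⟩ ⟨χ, hχ, hr⟩
    refine ⟨fun n => φ n + χ n, hφ.add hS hχ, fun v ψ hψ => ?_⟩
    simp only [Submodule.coe_add, Prod.snd_add, inner_add_left]
    exact (hp v ψ hψ).add (hr v ψ hψ)
  smul_mem' := by
    rintro a p ⟨φ, hφ, hp⟩
    refine ⟨fun n => a • φ n, hφ.smul a, fun v ψ hψ => ?_⟩
    simp only [Submodule.coe_smul, Prod.smul_snd, inner_smul_left]
    exact (hp v ψ hψ).const_mul _

/-- The Friedrichs extension of a densely defined nonnegative symmetric operator `S`: the operator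
associated with the closure of the quadratic form of `S`. -/
def friedrichs (S : H →ₗ.[ℂ] H) (hS : IsNonnegSymmetric S) : H →ₗ.[ℂ] H :=
  (friedrichsGraph S hS).toLinearPMap

/-- The graph above is single-valued, hence it is the graph of the operator. -/
theorem friedrichs_graph (S : H →ₗ.[ℂ] H) (hS : IsNonnegSymmetric S) :
    (friedrichs S hS).graph = friedrichsGraph S hS := by
  refine Submodule.toLinearPMap_graph_eq _ ?_
  rintro ⟨u, w⟩ ⟨φ, hφ, h⟩ rfl
  refine hS.dense.eq_zero_of_inner_left (𝕜 := ℂ) fun v hv => ?_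
  lift v to S.domain using hv
  have h1 := h v (fun _ => v) (FormConverges.const S v)
  have h2 := hφ.1.inner (𝕜 := ℂ) (tendsto_const_nhds (x := S v))
  have := tendsto_nhds_unique h1 h2
  simpa using this

end Friedrichs

/-! ### Networks and the energy form -/

/-- A connected network `(V, E, c)`: a symmetric loop-free edge relation in which every vertex has
finitely many neighbours and at least one, which is connected, together with a conductance
function. The conductance is extended by `0` to the pairs that are not edges. -/
structure Network (V : Type*) where
  graph : SimpleGraph V
  finite_nbrs : ∀ x, (graph.neighborSet x).Finite
  exists_nbr : ∀ x, (graph.neighborSet x).Nonempty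
  connected : graph.Connected
  c : V → V → ℝ
  c_symm : ∀ x y, c x y = c y x
  c_pos : ∀ x y, graph.Adj x y → 0 < c x y
  c_off : ∀ x y, ¬ graph.Adj x y → c x y = 0

namespace Network

variable {V : Type*} (N : Network V)

theorem c_nonneg (x y : V) : 0 ≤ N.c x y := by
  by_cases h : N.graph.Adj x y
  · exact (N.c_pos x y h).le
  · exact (N.c_off x y h).ge

/-- The finite set `E(x)` of neighbours of `x`. -/
def nbrs (x : V) : Finset V := (N.finite_nbrs x).toFinset

/-- The graph Laplacian `(Δu)(x) = ∑_{y ∼ x} c_{xy} (u(x) - u(y))` on all functions on `V`. -/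
def lap : (V → ℂ) →ₗ[ℂ] (V → ℂ) where
  toFun u x := ∑ y ∈ N.nbrs x, (N.c x y : ℂ) * (u x - u y)
  map_add' u v := by
    funext x
    simp only [Pi.add_apply, ← Finset.sum_add_distrib]
    exact Finset.sum_congr rfl fun y _ => by ring
  map_smul' a u := by
    funext x
    simp only [Pi.smul_apply, smul_eq_mul, RingHom.id_apply, Finset.mul_sum]
    exact Finset.sum_congr rfl fun y _ => by ring

/-- The term of the energy form at the pair `p = (x, y)`. -/
def term (u v : V → ℂ) (p : V × V) : ℂ :=
  (N.c p.1 p.2 : ℂ) * (starRingEnd ℂ (u p.1 - u p.2) * (v p.1 - v p.2))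

theorem norm_term_le (u v : V → ℂ) (p : V × V) :
    ‖N.term u v p‖ ≤ N.c p.1 p.2 * ‖u p.1 - u p.2‖ ^ 2 + N.c p.1 p.2 * ‖v p.1 - v p.2‖ ^ 2 := by
  have h : ‖N.term u v p‖ = N.c p.1 p.2 * (‖u p.1 - u p.2‖ * ‖v p.1 - v p.2‖) := by
    simp only [term, norm_mul, Complex.norm_real, RCLike.norm_conj,
      Real.norm_of_nonneg (N.c_nonneg p.1 p.2)]
  rw [h, ← mul_add]
  refine mul_le_mul_of_nonneg_left ?_ (N.c_nonneg _ _)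
  nlinarith [sq_nonneg (‖u p.1 - u p.2‖ - ‖v p.1 - v p.2‖), sq_nonneg (‖u p.1 - u p.2‖),
    sq_nonneg (‖v p.1 - v p.2‖)]

/-- The functions `u : V → ℂ` of finite energy, `∑ c_{xy} |u(x) - u(y)|² < ∞`. -/
def finiteEnergy : Submodule ℂ (V → ℂ) where
  carrier := {u | Summable fun p : V × V => N.c p.1 p.2 * ‖u p.1 - u p.2‖ ^ 2}
  zero_mem' := by simp [summable_zero]
  add_mem' {u v} hu hv := by
    refine Summable.of_nonneg_of_le (fun p => mul_nonneg (N.c_nonneg _ _) (sq_nonneg _))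
      (fun p => ?_) ((Summable.add hu hv).mul_left 2)
    have h1 : ‖(u + v) p.1 - (u + v) p.2‖ ≤ ‖u p.1 - u p.2‖ + ‖v p.1 - v p.2‖ := by
      have : (u + v) p.1 - (u + v) p.2 = (u p.1 - u p.2) + (v p.1 - v p.2) := by
        simp only [Pi.add_apply]; ring
      rw [this]; exact norm_add_le _ _
    have h2 : ‖(u + v) p.1 - (u + v) p.2‖ ^ 2
        ≤ 2 * (‖u p.1 - u p.2‖ ^ 2 + ‖v p.1 - v p.2‖ ^ 2) := by
      nlinarith [norm_nonneg ((u + v) p.1 - (u + v) p.2),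
        sq_nonneg (‖u p.1 - u p.2‖ - ‖v p.1 - v p.2‖)]
    calc _ ≤ N.c p.1 p.2 * (2 * (‖u p.1 - u p.2‖ ^ 2 + ‖v p.1 - v p.2‖ ^ 2)) :=
          mul_le_mul_of_nonneg_left h2 (N.c_nonneg _ _)
      _ = _ := by ring
  smul_mem' a u hu := by
    refine (Summable.mul_left (‖a‖ ^ 2) hu).congr fun p => ?_
    simp only [Pi.smul_apply, smul_eq_mul, ← mul_sub, norm_mul]
    ring

theorem mem_finiteEnergy {u : V → ℂ} : u ∈ N.finiteEnergy ↔
    Summable fun p : V × V => N.c p.1 p.2 * ‖u p.1 - u p.2‖ ^ 2 := Iff.rfl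

theorem summable_term {u v : V → ℂ} (hu : u ∈ N.finiteEnergy) (hv : v ∈ N.finiteEnergy) :
    Summable (N.term u v) :=
  Summable.of_norm_bounded (Summable.add hu hv) (N.norm_term_le u v)

theorem term_self (u : V → ℂ) (p : V × V) :
    N.term u u p = ((N.c p.1 p.2 * ‖u p.1 - u p.2‖ ^ 2 : ℝ) : ℂ) := by
  simp only [term, Complex.conj_mul']
  push_cast
  rfl

/-- The vector space of functions of finite energy, as a type of its own: it carries the topology
of the energy seminorm, not that of pointwise convergence. -/
def EnergyFun : Type _ := N.finiteEnergy

instance : AddCommGroup N.EnergyFun := inferInstanceAs (AddCommGroup N.finiteEnergy)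

instance : Module ℂ N.EnergyFun := inferInstanceAs (Module ℂ N.finiteEnergy)

/-- A function of finite energy as an element of `EnergyFun`. -/
def toEnergyFun : N.finiteEnergy ≃ₗ[ℂ] N.EnergyFun := LinearEquiv.refl ℂ N.finiteEnergy

variable {N} in
/-- The underlying function on `V`. -/
def EnergyFun.fn (u : N.EnergyFun) : V → ℂ := (N.toEnergyFun.symm u).1

variable {N} in
theorem EnergyFun.fn_mem (u : N.EnergyFun) : u.fn ∈ N.finiteEnergy := (N.toEnergyFun.symm u).2

variable {N} in
theorem EnergyFun.fn_add (u v : N.EnergyFun) : (u + v).fn = u.fn + v.fn := rfl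

variable {N} in
theorem EnergyFun.fn_smul (a : ℂ) (u : N.EnergyFun) : (a • u).fn = a • u.fn := rfl

theorem fn_toEnergyFun (u : N.finiteEnergy) : (N.toEnergyFun u).fn = u.1 := rfl

/-- The energy form `½ ∑_{(x,y) ∈ E} c_{xy} conj(u(x) - u(y)) (v(x) - v(y))`, conjugate linear in
the first variable. -/
abbrev energyCore : PreInnerProductSpace.Core ℂ N.EnergyFun where
  inner u v := (1 / 2 : ℂ) * ∑' p : V × V, N.term u.fn v.fn p
  conj_inner_symm u v := by
    rw [map_mul, Complex.conj_tsum]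
    congr 1
    · simp [Complex.conj_ofNat]
    · refine tsum_congr fun p => ?_
      simp only [term, map_mul, Complex.conj_conj, Complex.conj_ofReal]
      ring
  re_inner_nonneg u := by
    have h : (∑' p : V × V, N.term u.fn u.fn p)
        = ((∑' p : V × V, N.c p.1 p.2 * ‖u.fn p.1 - u.fn p.2‖ ^ 2 : ℝ) : ℂ) := by
      rw [Complex.ofReal_tsum]
      exact tsum_congr fun p => N.term_self u.fn p
    have h2 : (0 : ℝ) ≤ ∑' p : V × V, N.c p.1 p.2 * ‖u.fn p.1 - u.fn p.2‖ ^ 2 :=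
      tsum_nonneg fun p => mul_nonneg (N.c_nonneg _ _) (sq_nonneg _)
    rw [h]
    have h3 : (1 / 2 : ℂ) = ((1 / 2 : ℝ) : ℂ) := by norm_num
    rw [h3, ← Complex.ofReal_mul]
    simp only [RCLike.re_to_complex, Complex.ofReal_re]
    positivity
  add_left u v w := by
    rw [← mul_add, ← (N.summable_term u.fn_mem w.fn_mem).tsum_add (N.summable_term v.fn_mem w.fn_mem)]
    congr 1
    refine tsum_congr fun p => ?_
    simp only [term, EnergyFun.fn_add, Pi.add_apply, map_sub, map_add]
    ring
  smul_left u v a := by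
    rw [mul_left_comm]
    congr 1
    rw [← tsum_mul_left]
    refine tsum_congr fun p => ?_
    simp only [term, EnergyFun.fn_smul, Pi.smul_apply, smul_eq_mul, map_sub, map_mul]
    ring

instance : SeminormedAddCommGroup N.EnergyFun :=
  @InnerProductSpace.Core.toSeminormedAddCommGroup ℂ _ _ _ _ N.energyCore

instance : InnerProductSpace ℂ N.EnergyFun := InnerProductSpace.ofCore N.energyCore

theorem inner_def (u v : N.EnergyFun) :
    inner ℂ u v = (1 / 2 : ℂ) * ∑' p : V × V, N.term u.fn v.fn p := rfl

theorem norm_sq_eq (u : N.EnergyFun) : ‖u‖ ^ 2 =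
    1 / 2 * ∑' p : V × V, N.c p.1 p.2 * ‖u.fn p.1 - u.fn p.2‖ ^ 2 := by
  have h1 : (∑' p : V × V, N.term u.fn u.fn p)
      = ((∑' p : V × V, N.c p.1 p.2 * ‖u.fn p.1 - u.fn p.2‖ ^ 2 : ℝ) : ℂ) := by
    rw [Complex.ofReal_tsum]
    exact tsum_congr fun p => N.term_self u.fn p
  have h3 : (1 / 2 : ℂ) = ((1 / 2 : ℝ) : ℂ) := by norm_num
  rw [@norm_sq_eq_re_inner ℂ, inner_def, h1, h3, ← Complex.ofReal_mul]
  rfl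

/-- The energy space `H_E`: functions of finite energy with the energy inner product, two functions
being identified when their difference has zero energy, that is (by connectedness), when it is
constant. -/
abbrev HE : Type _ := SeparationQuotient N.EnergyFun

/-- The vector of `H_E` given by a function of finite energy. -/
def toHE : N.finiteEnergy →ₗ[ℂ] N.HE :=
  (SeparationQuotient.mkCLM ℂ N.EnergyFun).toLinearMap ∘ₗ N.toEnergyFun.toLinearMap

theorem inner_toHE (u v : N.finiteEnergy) :
    inner ℂ (N.toHE u) (N.toHE v) = (1 / 2 : ℂ) * ∑' p : V × V, N.term u.1 v.1 p := rfl

theorem toHE_surjective : Function.Surjective N.toHE := fun f => by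
  obtain ⟨u, rfl⟩ := SeparationQuotient.surjective_mk f
  exact ⟨N.toEnergyFun.symm u, rfl⟩

/-! ### Completeness of the energy space -/

theorem norm_gradTerm_sq (u : V → ℂ) (p : V × V) :
    ‖((√(N.c p.1 p.2 / 2) : ℝ) : ℂ) * (u p.1 - u p.2)‖ ^ (2 : ℝ)
      = 1 / 2 * (N.c p.1 p.2 * ‖u p.1 - u p.2‖ ^ 2) := by
  have h : 0 ≤ N.c p.1 p.2 / 2 := div_nonneg (N.c_nonneg _ _) zero_le_two
  rw [Real.rpow_two, norm_mul, mul_pow, Complex.norm_real, Real.norm_of_nonneg (Real.sqrt_nonneg _),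
    Real.sq_sqrt h]
  ring

theorem memlp_iff (u : V → ℂ) :
    Memℓp (fun p : V × V => ((√(N.c p.1 p.2 / 2) : ℝ) : ℂ) * (u p.1 - u p.2)) 2
      ↔ u ∈ N.finiteEnergy := by
  rw [memℓp_gen_iff (by norm_num), mem_finiteEnergy]
  simp only [ENNReal.toReal_ofNat, norm_gradTerm_sq]
  exact summable_mul_left_iff (by norm_num)

/-- The gradient `u ↦ (√(c_{xy} / 2) (u(x) - u(y)))_{x, y}`, an isometry into `ℓ²(V × V)`. -/
def grad : N.EnergyFun →ₗᵢ[ℂ] lp (fun _ : V × V => ℂ) 2 where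
  toFun u := ⟨fun p => ((√(N.c p.1 p.2 / 2) : ℝ) : ℂ) * (u.fn p.1 - u.fn p.2),
    (N.memlp_iff u.fn).2 u.fn_mem⟩
  map_add' u v := by
    ext p
    simp only [EnergyFun.fn_add, Pi.add_apply, lp.coeFn_add]
    ring
  map_smul' a u := by
    ext p
    simp only [EnergyFun.fn_smul, Pi.smul_apply, lp.coeFn_smul, smul_eq_mul, RingHom.id_apply]
    ring
  norm_map' u := by
    refine (sq_eq_sq₀ (norm_nonneg _) (norm_nonneg _)).1 ?_
    have h := lp.norm_rpow_eq_tsum (p := 2) (by norm_num)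
      (⟨fun p => ((√(N.c p.1 p.2 / 2) : ℝ) : ℂ) * (u.fn p.1 - u.fn p.2),
        (N.memlp_iff u.fn).2 u.fn_mem⟩ : lp (fun _ : V × V => ℂ) 2)
    rw [ENNReal.toReal_ofNat, tsum_congr fun p => N.norm_gradTerm_sq u.fn p, tsum_mul_left,
      ← norm_sq_eq, Real.rpow_two] at h
    exact h

theorem grad_apply (u : N.EnergyFun) (p : V × V) :
    N.grad u p = ((√(N.c p.1 p.2 / 2) : ℝ) : ℂ) * (u.fn p.1 - u.fn p.2) := rfl

theorem sqrt_pos_of_adj {x y : V} (h : N.graph.Adj x y) : 0 < √(N.c x y / 2) :=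
  Real.sqrt_pos.2 (half_pos (N.c_pos x y h))

theorem reflTransGen (x y : V) : Relation.ReflTransGen N.graph.Adj x y :=
  (SimpleGraph.reachable_iff_reflTransGen x y).1 (N.connected.preconnected x y)

theorem isClosed_range_grad : IsClosed (Set.range N.grad) := by
  refine IsSeqClosed.isClosed fun g g0 hg hlim => ?_
  choose u hu using hg
  have hcoord : ∀ p : V × V, Tendsto (fun n => g n p) atTop (𝓝 (g0 p)) := by
    intro p
    rw [tendsto_iff_norm_sub_tendsto_zero] at hlim ⊢
    refine squeeze_zero (fun _ => norm_nonneg _) (fun n => ?_) hlim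
    have := lp.norm_apply_le_norm (p := 2) (by norm_num) (g n - g0) p
    simpa using this
  obtain ⟨o⟩ := N.connected.nonempty
  have hconv : ∀ x, ∃ l, Tendsto (fun n => (u n).fn x - (u n).fn o) atTop (𝓝 l) := by
    intro x
    induction N.reflTransGen o x with
    | refl => exact ⟨0, by simp⟩
    | @tail y z _ hyz ih =>
      obtain ⟨l, hl⟩ := ih
      have hs : ((√(N.c y z / 2) : ℝ) : ℂ) ≠ 0 :=
        Complex.ofReal_ne_zero.2 (N.sqrt_pos_of_adj hyz).ne'
      refine ⟨l - ((√(N.c y z / 2) : ℝ) : ℂ)⁻¹ * g0 (y, z),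
        (hl.sub ((hcoord (y, z)).const_mul (((√(N.c y z / 2) : ℝ) : ℂ)⁻¹))).congr fun n => ?_⟩
      rw [← hu n, grad_apply, inv_mul_cancel_left₀ hs]
      ring
  choose l hl using hconv
  have hg0 : ∀ p : V × V, g0 p = ((√(N.c p.1 p.2 / 2) : ℝ) : ℂ) * (l p.1 - l p.2) := by
    intro p
    refine tendsto_nhds_unique (hcoord p)
      ((((hl p.1).sub (hl p.2)).const_mul ((√(N.c p.1 p.2 / 2) : ℝ) : ℂ)).congr fun n => ?_)
    rw [← hu n, grad_apply]
    ring
  have hmem : l ∈ N.finiteEnergy := by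
    rw [← N.memlp_iff]
    have := lp.memℓp g0
    rwa [show (g0 : ∀ _ : V × V, ℂ) = _ from funext hg0] at this
  refine ⟨N.toEnergyFun ⟨l, hmem⟩, lp.ext (funext fun p => ?_)⟩
  rw [hg0 p, grad_apply, fn_toEnergyFun]

instance : CompleteSpace N.EnergyFun :=
  (completeSpace_iff_isComplete_range N.grad.isometry.isUniformInducing).2
    N.isClosed_range_grad.isComplete

/-! ### Dipoles -/

theorem exists_drop_bound (x y : V) :
    ∃ C : ℝ, ∀ u : N.EnergyFun, ‖u.fn x - u.fn y‖ ≤ C * ‖u‖ := by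
  induction N.reflTransGen x y with
  | refl => exact ⟨0, fun u => by simp⟩
  | @tail y z _ hyz ih =>
    obtain ⟨C, hC⟩ := ih
    refine ⟨C + (√(N.c y z / 2))⁻¹, fun u => ?_⟩
    have hs := N.sqrt_pos_of_adj hyz
    have h1 : √(N.c y z / 2) * ‖u.fn y - u.fn z‖ ≤ ‖u‖ := by
      have := lp.norm_apply_le_norm (p := 2) (by norm_num) (N.grad u) (y, z)
      rwa [grad_apply, norm_mul, Complex.norm_real, Real.norm_of_nonneg hs.le,
        N.grad.norm_map] at this
    have h2 : ‖u.fn y - u.fn z‖ ≤ (√(N.c y z / 2))⁻¹ * ‖u‖ := by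
      rw [inv_mul_eq_div, le_div_iff₀ hs]
      linarith
    calc ‖u.fn x - u.fn z‖ = ‖(u.fn x - u.fn y) + (u.fn y - u.fn z)‖ := by congr 1; ring
      _ ≤ ‖u.fn x - u.fn y‖ + ‖u.fn y - u.fn z‖ := norm_add_le _ _
      _ ≤ _ := by rw [add_mul]; exact add_le_add (hC u) h2

/-- The functional `u ↦ u(x) - u(y)` on functions of finite energy. -/
def dropFun (x y : V) : N.EnergyFun →L[ℂ] ℂ :=
  LinearMap.mkContinuousOfExistsBound
    { toFun := fun u => u.fn x - u.fn y
      map_add' := fun u v => by simp only [EnergyFun.fn_add, Pi.add_apply]; ring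
      map_smul' := fun a u => by
        simp only [EnergyFun.fn_smul, Pi.smul_apply, smul_eq_mul, RingHom.id_apply]; ring }
    (N.exists_drop_bound x y)

/-- The functional `u ↦ u(x) - u(y)` on `H_E`. -/
def drop (x y : V) : N.HE →L[ℂ] ℂ :=
  SeparationQuotient.liftCLM (N.dropFun x y) fun _ _ h => (h.map (N.dropFun x y).continuous).eq

theorem drop_toHE (x y : V) (u : N.finiteEnergy) : N.drop x y (N.toHE u) = u.1 x - u.1 y := rfl

/-- The dipole `v_{xy} ∈ H_E`, the unique vector with `⟨v_{xy}, u⟩ = u(x) - u(y)` for all `u`. -/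
def dipole (x y : V) : N.HE := (InnerProductSpace.toDual ℂ N.HE).symm (N.drop x y)

theorem inner_dipole (x y : V) (f : N.HE) : inner ℂ (N.dipole x y) f = N.drop x y f :=
  InnerProductSpace.toDual_symm_apply

/-! ### The Laplacian on the span of the dipoles -/

/-- The function `Δf` on `V` for `f ∈ H_E`; it depends only on the differences of `f`. -/
def lapHE : N.HE →ₗ[ℂ] (V → ℂ) where
  toFun f x := ∑ y ∈ N.nbrs x, (N.c x y : ℂ) * N.drop x y f
  map_add' f g := by
    funext x
    simp only [map_add, mul_add, Finset.sum_add_distrib, Pi.add_apply]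
  map_smul' a f := by
    funext x
    simp only [map_smul, smul_eq_mul, Pi.smul_apply, RingHom.id_apply, Finset.mul_sum]
    exact Finset.sum_congr rfl fun y _ => by ring

theorem lapHE_toHE (u : N.finiteEnergy) : N.lapHE (N.toHE u) = N.lap u.1 := rfl

theorem mem_nbrs {x y : V} : y ∈ N.nbrs x ↔ N.graph.Adj x y := by
  simp [nbrs]

open scoped Classical in
/-- The point mass `δ_x`. -/
def delta (x : V) : V → ℂ := fun y => if y = x then 1 else 0

open scoped Classical in
theorem term_delta_eq_zero (x : V) (p : V × V)
    (hp : p ∉ (N.nbrs x).image (fun y => (x, y)) ∪ (N.nbrs x).image (fun y => (y, x))) :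
    N.c p.1 p.2 = 0 ∨ delta x p.1 - delta x p.2 = 0 := by
  obtain ⟨a, b⟩ := p
  by_cases hab : N.graph.Adj a b
  · right
    simp only [Finset.mem_union, Finset.mem_image, mem_nbrs, Prod.mk.injEq, not_or, not_exists,
      not_and] at hp
    have ha : a ≠ x := by
      rintro rfl
      exact hp.1 b hab rfl rfl
    have hb : b ≠ x := by
      rintro rfl
      exact hp.2 a hab.symm rfl rfl
    simp [delta, ha, hb]
  · exact Or.inl (N.c_off a b hab)

theorem delta_mem (x : V) : delta x ∈ N.finiteEnergy := by
  classical
  refine summable_of_ne_finset_zero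
    (s := (N.nbrs x).image (fun y => (x, y)) ∪ (N.nbrs x).image (fun y => (y, x))) fun p hp => ?_
  rcases N.term_delta_eq_zero x p hp with h | h <;> simp [h]

theorem inner_delta (x : V) (f : N.HE) :
    inner ℂ (N.toHE ⟨delta x, N.delta_mem x⟩) f = N.lapHE f x := by
  classical
  obtain ⟨u, rfl⟩ := N.toHE_surjective f
  rw [inner_toHE, lapHE_toHE, tsum_eq_sum
    (s := (N.nbrs x).image (fun y => (x, y)) ∪ (N.nbrs x).image (fun y => (y, x)))
    (fun p hp => by rcases N.term_delta_eq_zero x p hp with h | h <;> simp [term, h])]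
  have hne : ∀ y ∈ N.nbrs x, y ≠ x := fun y hy => (N.mem_nbrs.1 hy).ne'
  rw [Finset.sum_union, Finset.sum_image (by intro a _ b _ h; exact (Prod.mk.inj h).2),
    Finset.sum_image (by intro a _ b _ h; exact (Prod.mk.inj h).1), ← Finset.sum_add_distrib,
    Finset.mul_sum]
  · refine Finset.sum_congr rfl fun y hy => ?_
    simp only [term, delta, if_neg (hne y hy), if_true, N.c_symm y x]
    simp
    ring
  · rw [Finset.disjoint_left]
    intro p h1 h2
    obtain ⟨y, hy, rfl⟩ := Finset.mem_image.1 h1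
    obtain ⟨z, hz, h⟩ := Finset.mem_image.1 h2
    exact hne z hz (Prod.mk.inj h).1

theorem lapHE_dipole (x y : V) : N.lapHE (N.dipole x y) = delta x - delta y := by
  classical
  funext z
  rw [← inner_delta, ← inner_conj_symm, inner_dipole, drop_toHE]
  simp only [delta, Pi.sub_apply, map_sub, apply_ite (starRingEnd ℂ), map_one, map_zero,
    eq_comm (a := z)]

/-- The dense domain `D_E`, the span of the dipoles `v_x = v_{xo}` with `x ≠ o`. -/
def DE (o : V) : Submodule ℂ N.HE :=
  Submodule.span ℂ (Set.range fun x : {x : V // x ≠ o} => N.dipole x o)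

theorem lapHE_mem (o : V) (φ : N.DE o) : N.lapHE φ ∈ N.finiteEnergy := by
  have h : N.DE o ≤ N.finiteEnergy.comap N.lapHE := by
    refine Submodule.span_le.2 ?_
    rintro _ ⟨x, rfl⟩
    simp only [SetLike.mem_coe, Submodule.mem_comap, lapHE_dipole]
    exact sub_mem (N.delta_mem x) (N.delta_mem o)
  exact h φ.2

/-- The graph Laplacian as an operator in `H_E` with domain `D_E`. -/
def lapOp (o : V) : N.HE →ₗ.[ℂ] N.HE where
  domain := N.DE o
  toFun := N.toHE ∘ₗ (N.lapHE ∘ₗ (N.DE o).subtype).codRestrict N.finiteEnergy (N.lapHE_mem o)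

theorem drop_lapOp (o x y : V) (φ : N.DE o) :
    N.drop x y (N.lapOp o φ) = N.lapHE φ x - N.lapHE φ y := rfl

/-- The vector `∑ ξ_x v_x` of `D_E`, for `ξ` finitely supported on `V` without `o`. -/
def dipoleSum (o : V) (ξ : {x : V // x ≠ o} →₀ ℂ) : N.DE o :=
  ⟨ξ.sum fun x a => a • N.dipole x o, Submodule.sum_mem _ fun x _ =>
    Submodule.smul_mem _ _ (Submodule.subset_span ⟨x, rfl⟩)⟩

theorem exists_dipoleSum (o : V) (φ : N.DE o) : ∃ ξ, N.dipoleSum o ξ = φ := by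
  obtain ⟨ξ, hξ⟩ := (Finsupp.mem_span_range_iff_exists_finsupp).1 φ.2
  exact ⟨ξ, Subtype.ext hξ⟩

theorem drop_lapOp_dipoleSum (o : V) (η : {x : V // x ≠ o} →₀ ℂ) (x : {x : V // x ≠ o}) :
    N.drop x o (N.lapOp o (N.dipoleSum o η)) = η x + η.sum fun _ a => a := by
  have h : N.lapHE (N.dipoleSum o η : N.HE)
      = η.sum fun y a => a • (delta (y : V) - delta o) := by
    simp only [dipoleSum, Finsupp.sum, map_sum, map_smul, lapHE_dipole]
  rw [drop_lapOp, h]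
  have hx : ∀ y : {x : V // x ≠ o}, ((x : V) = y) = (y = x) := fun y =>
    propext ⟨fun h => Subtype.ext h.symm, fun h => congrArg Subtype.val h.symm⟩
  have ho : ∀ y : {x : V // x ≠ o}, (o = (y : V)) = False := fun y =>
    eq_false y.2.symm
  simp only [Finsupp.sum, Finset.sum_apply, Pi.smul_apply, Pi.sub_apply, delta, smul_eq_mul, hx,
    ho, if_neg x.2, if_true, if_false, ← Finset.sum_sub_distrib, sub_zero, zero_sub, mul_neg,
    mul_one, sub_neg_eq_add, Finset.sum_add_distrib, mul_ite, mul_zero]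
  congr 1
  rw [Finset.sum_eq_single x (fun y _ hy => if_neg fun h => hy (Subtype.ext h.symm))
    (fun h => by simp [Finsupp.notMem_support_iff.1 h]), if_pos rfl]

theorem inner_lapOp (o : V) (ξ η : {x : V // x ≠ o} →₀ ℂ) :
    inner ℂ (N.dipoleSum o ξ : N.HE) (N.lapOp o (N.dipoleSum o η))
      = (ξ.sum fun x a => starRingEnd ℂ a * η x)
        + starRingEnd ℂ (ξ.sum fun _ a => a) * η.sum fun _ a => a := by
  have h : (N.dipoleSum o ξ : N.HE) = ∑ x ∈ ξ.support, ξ x • N.dipole x o := rfl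
  rw [h, sum_inner]
  simp only [inner_smul_left, inner_dipole, drop_lapOp_dipoleSum, mul_add, Finset.sum_add_distrib,
    Finsupp.sum, map_sum, Finset.sum_mul]

theorem eq_zero_of_drop (o : V) (f : N.HE) (h : ∀ x, N.drop x o f = 0) : f = 0 := by
  obtain ⟨u, rfl⟩ := N.toHE_surjective f
  have hu : ∀ x, u.1 x = u.1 o := fun x => sub_eq_zero.1 (h x)
  rw [← norm_eq_zero, ← sq_eq_zero_iff, @norm_sq_eq_re_inner ℂ, inner_toHE]
  simp [term, hu]

theorem isNonnegSymmetric_lapOp (o : V) : IsNonnegSymmetric (N.lapOp o) where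
  dense := by
    rw [Submodule.dense_iff_topologicalClosure_eq_top, Submodule.topologicalClosure_eq_top_iff,
      Submodule.eq_bot_iff]
    intro f hf
    refine N.eq_zero_of_drop o f fun x => ?_
    rw [← inner_dipole]
    by_cases hx : x = o
    · rw [hx, inner_dipole]
      obtain ⟨u, rfl⟩ := N.toHE_surjective f
      rw [drop_toHE, sub_self]
    · exact (Submodule.mem_orthogonal _ f).1 hf _ (Submodule.subset_span ⟨⟨x, hx⟩, rfl⟩)
  symm φ ψ := by
    obtain ⟨ξ, rfl⟩ := N.exists_dipoleSum o φ
    obtain ⟨η, rfl⟩ := N.exists_dipoleSum o ψ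
    rw [← inner_conj_symm, inner_lapOp, inner_lapOp, map_add, map_mul, Complex.conj_conj,
      mul_comm (η.sum fun _ a => a)]
    congr 1
    classical
    rw [Finsupp.sum_of_support_subset η (Finset.subset_union_right (s₁ := ξ.support)) _ (by simp),
      Finsupp.sum_of_support_subset ξ (Finset.subset_union_left (s₂ := η.support)) _ (by simp),
      map_sum]
    exact Finset.sum_congr rfl fun x _ => by rw [map_mul, Complex.conj_conj, mul_comm]
  nonneg φ := by
    obtain ⟨ξ, rfl⟩ := N.exists_dipoleSum o φ
    rw [inner_lapOp, Complex.add_re, Complex.conj_mul', Finsupp.sum, Complex.re_sum]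
    refine add_nonneg (Finset.sum_nonneg fun x _ => ?_) ?_
    · rw [Complex.conj_mul', ← Complex.ofReal_pow, Complex.ofReal_re]
      positivity
    · rw [← Complex.ofReal_pow, Complex.ofReal_re]
      positivity

/-- The Friedrichs extension `Δ_Fri` of the graph Laplacian with domain `D_E` in `H_E`. -/
def lapFri (o : V) : N.HE →ₗ.[ℂ] N.HE := friedrichs (N.lapOp o) (N.isNonnegSymmetric_lapOp o)

end Network

end

/-!
The Friedrichs extension of `S` is the restriction of the adjoint `S†` to the form domain: by
Cauchy–Schwarz for the form, the first argument of `⟨φ_n, Sψ_n⟩` may be replaced by the limit `u`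
of `φ_n`, and `⟨u, Sψ_n⟩ = ⟨S†u, ψ_n⟩` is continuous for the norm of `H`.
For the network, `Δv_x = δ_x - δ_o` and `⟨δ_x, f⟩ = (Δf)(x)`, so `w` is the value at `f` of the
adjoint if and only if `w(x) - w(o) = (Δf)(x) - (Δf)(o)` for all `x`, that is, `w` is the class
of `Δf`. Hence `f` is in the domain of the adjoint if and only if `Δf` has finite energy.
-/

open scoped InnerProductSpace LinearPMap

section FriedrichsDomain

variable {H : Type*} [NormedAddCommGroup H] [InnerProductSpace ℂ H] {S : H →ₗ.[ℂ] H}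

namespace IsNonnegSymmetric

/-- The form `⟨φ, Sψ⟩` of a nonnegative symmetric operator, as a pre-inner product on its domain. -/
noncomputable abbrev formCore (hS : IsNonnegSymmetric S) :
    PreInnerProductSpace.Core ℂ S.domain where
  inner φ ψ := ⟪(φ : H), S ψ⟫_ℂ
  conj_inner_symm φ ψ := by rw [inner_conj_symm, hS.symm]
  re_inner_nonneg := hS.nonneg
  add_left φ ψ χ := by rw [Submodule.coe_add, inner_add_left]
  smul_left φ ψ a := by rw [Submodule.coe_smul, inner_smul_left]

/-- The seminorm `φ ↦ √⟨φ, Sφ⟩` of the form. It is not made a norm instance, because the domain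
already carries the norm of `H`. -/
noncomputable def formSeminorm (hS : IsNonnegSymmetric S) : Seminorm ℂ S.domain :=
  letI := InnerProductSpace.Core.toSeminormedAddCommGroup (c := hS.formCore)
  letI := InnerProductSpace.ofCore hS.formCore
  normSeminorm ℂ S.domain

theorem formSeminorm_apply (hS : IsNonnegSymmetric S) (φ : S.domain) :
    hS.formSeminorm φ = √(⟪(φ : H), S φ⟫_ℂ).re := rfl

theorem norm_inner_map_le (hS : IsNonnegSymmetric S) (φ ψ : S.domain) :
    ‖⟪(φ : H), S ψ⟫_ℂ‖ ≤ hS.formSeminorm φ * hS.formSeminorm ψ :=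
  InnerProductSpace.Core.norm_inner_le_norm (c := hS.formCore) φ ψ

theorem norm_inner_sub_map_le (hS : IsNonnegSymmetric S) {φ : ℕ → S.domain} {u : H}
    (hφ : Tendsto (fun n => (φ n : H)) atTop (𝓝 u)) {χ : S.domain} {ε : ℝ}
    (hχ : ∀ᶠ m in atTop, hS.formSeminorm (χ - φ m) ≤ ε) (ψ : S.domain) :
    ‖⟪(χ : H) - u, S ψ⟫_ℂ‖ ≤ ε * hS.formSeminorm ψ := by
  refine le_of_tendsto ((hφ.const_sub (χ : H)).inner tendsto_const_nhds).norm ?_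
  filter_upwards [hχ] with m hm
  calc ‖⟪(χ : H) - φ m, S ψ⟫_ℂ‖
      ≤ hS.formSeminorm (χ - φ m) * hS.formSeminorm ψ := hS.norm_inner_map_le (χ - φ m) ψ
    _ ≤ ε * hS.formSeminorm ψ := by gcongr

end IsNonnegSymmetric

namespace FormConverges

variable {φ ψ : ℕ → S.domain} {u v : H}

theorem eventually_formSeminorm_sub_lt (hS : IsNonnegSymmetric S) (hφ : FormConverges S φ u)
    {ε : ℝ} (hε : 0 < ε) : ∀ᶠ n in atTop, ∀ᶠ m in atTop, hS.formSeminorm (φ n - φ m) < ε := by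
  have h : Tendsto (fun p : ℕ × ℕ => hS.formSeminorm (φ p.1 - φ p.2)) (atTop ×ˢ atTop) (𝓝 0) := by
    simpa only [IsNonnegSymmetric.formSeminorm_apply, Real.sqrt_zero, prod_atTop_atTop_eq]
      using hφ.2.sqrt
  exact (h.eventually_lt_const hε).curry

theorem isBigO_formSeminorm (hS : IsNonnegSymmetric S) (hψ : FormConverges S ψ v) :
    (fun n => hS.formSeminorm (ψ n)) =O[atTop] fun _ => (1 : ℝ) := by
  obtain ⟨k, hk⟩ := (hψ.eventually_formSeminorm_sub_lt hS one_pos).exists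
  refine Asymptotics.IsBigO.of_bound (hS.formSeminorm (ψ k) + 1) ?_
  filter_upwards [hk] with n hn
  rw [Real.norm_of_nonneg (apply_nonneg _ _), norm_one, mul_one]
  calc hS.formSeminorm (ψ n)
      = hS.formSeminorm (ψ k - (ψ k - ψ n)) := by rw [sub_sub_cancel]
    _ ≤ hS.formSeminorm (ψ k) + hS.formSeminorm (ψ k - ψ n) := map_sub_le_add _ _ _
    _ ≤ hS.formSeminorm (ψ k) + 1 := by gcongr

theorem tendsto_inner_sub_map (hS : IsNonnegSymmetric S) (hφ : FormConverges S φ u)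
    (hψ : FormConverges S ψ v) :
    Tendsto (fun n => ⟪(φ n : H) - u, S (ψ n)⟫_ℂ) atTop (𝓝 0) := by
  have h : (fun n => ⟪(φ n : H) - u, S (ψ n)⟫_ℂ) =o[atTop] fun n => hS.formSeminorm (ψ n) := by
    refine Asymptotics.IsLittleO.of_bound fun ε hε => ?_
    filter_upwards [hφ.eventually_formSeminorm_sub_lt hS hε] with n hn
    rw [Real.norm_of_nonneg (apply_nonneg _ _)]
    exact hS.norm_inner_sub_map_le hφ.1 (hn.mono fun _ => le_of_lt) (ψ n)
  exact (Asymptotics.isLittleO_one_iff ℝ).1 (h.trans_isBigO (hψ.isBigO_formSeminorm hS))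

end FormConverges

theorem mem_friedrichs_graph_iff (hS : IsNonnegSymmetric S) {u w : H} :
    (u, w) ∈ (friedrichs S hS).graph ↔
      u ∈ formDomain S ∧ ∀ ψ : S.domain, ⟪w, (ψ : H)⟫_ℂ = ⟪u, S ψ⟫_ℂ := by
  rw [friedrichs_graph]
  constructor
  · rintro ⟨φ, hφ, hw⟩
    exact ⟨⟨φ, hφ⟩, fun ψ => tendsto_nhds_unique (hw ψ (fun _ => ψ) (.const S ψ))
      (hφ.1.inner tendsto_const_nhds)⟩
  · rintro ⟨⟨φ, hφ⟩, hw⟩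
    refine ⟨φ, hφ, fun v ψ hψ => ?_⟩
    have hlim : Tendsto (fun n => ⟪w, (ψ n : H)⟫_ℂ) atTop (𝓝 ⟪w, v⟫_ℂ) :=
      tendsto_const_nhds.inner hψ.1
    simpa only [hw, ← inner_add_left, sub_add_cancel, zero_add]
      using (hφ.tendsto_inner_sub_map hS hψ).add hlim

theorem mem_adjoint_domain_iff_exists {𝕜 E F : Type*} [RCLike 𝕜] [NormedAddCommGroup E]
    [InnerProductSpace 𝕜 E] [NormedAddCommGroup F] [InnerProductSpace 𝕜 F] [CompleteSpace E]
    {T : E →ₗ.[𝕜] F} (hT : Dense (T.domain : Set E)) {y : F} :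
    y ∈ T†.domain ↔ ∃ w : E, ∀ x : T.domain, ⟪w, (x : E)⟫_𝕜 = ⟪y, T x⟫_𝕜 :=
  ⟨fun hy => ⟨T† ⟨y, hy⟩, T.adjoint_isFormalAdjoint hT ⟨y, hy⟩⟩,
    LinearPMap.mem_adjoint_domain_of_exists y⟩

theorem mem_friedrichs_domain_iff [CompleteSpace H] (hS : IsNonnegSymmetric S) {u : H} :
    u ∈ (friedrichs S hS).domain ↔ u ∈ formDomain S ∧ u ∈ S†.domain := by
  simp only [LinearPMap.mem_domain_iff, mem_friedrichs_graph_iff, exists_and_left,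
    mem_adjoint_domain_iff_exists hS.dense]

end FriedrichsDomain

namespace Network

variable {V : Type*} (N : Network V)

theorem drop_self (x : V) (f : N.HE) : N.drop x x f = 0 := by
  obtain ⟨u, rfl⟩ := N.toHE_surjective f
  rw [drop_toHE, sub_self]

theorem const_mem_finiteEnergy (a : ℂ) : Function.const V a ∈ N.finiteEnergy := by
  simp [mem_finiteEnergy, summable_zero]

theorem exists_forall_drop_eq_iff (o : V) {g : V → ℂ} :
    (∃ w : N.HE, ∀ x, N.drop x o w = g x - g o) ↔ g ∈ N.finiteEnergy := by
  refine ⟨?_, fun hg => ⟨N.toHE ⟨g, hg⟩, fun x => N.drop_toHE x o ⟨g, hg⟩⟩⟩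
  rintro ⟨w, hw⟩
  obtain ⟨u, rfl⟩ := N.toHE_surjective w
  have hg : g = u.1 + Function.const V (g o - u.1 o) := by
    funext x
    have hx : u.1 x - u.1 o = g x - g o := hw x
    simp only [Pi.add_apply, Function.const_apply]
    linear_combination -hx
  rw [hg]
  exact add_mem u.2 (N.const_mem_finiteEnergy _)

theorem dipole_mem_DE (o : V) (x : {x : V // x ≠ o}) : N.dipole x o ∈ N.DE o :=
  Submodule.subset_span ⟨x, rfl⟩

theorem inner_lapOp_dipole (o : V) (x : {x : V // x ≠ o}) (f : N.HE) :
    ⟪N.lapOp o ⟨N.dipole x o, N.dipole_mem_DE o x⟩, f⟫_ℂ = N.lapHE f x - N.lapHE f o := by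
  have hΔ : N.lapOp o ⟨N.dipole x o, N.dipole_mem_DE o x⟩
      = N.toHE (⟨delta x, N.delta_mem x⟩ - ⟨delta o, N.delta_mem o⟩) :=
    congrArg N.toHE (Subtype.ext (N.lapHE_dipole x o))
  rw [hΔ, map_sub, inner_sub_left, inner_delta, inner_delta]

theorem forall_inner_eq_inner_lapOp_iff (o : V) {f w : N.HE} :
    (∀ ψ : (N.lapOp o).domain, ⟪w, (ψ : N.HE)⟫_ℂ = ⟪f, N.lapOp o ψ⟫_ℂ) ↔
      ∀ x, N.drop x o w = N.lapHE f x - N.lapHE f o := by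
  have hspan : (∀ ψ : (N.lapOp o).domain, ⟪w, (ψ : N.HE)⟫_ℂ = ⟪f, N.lapOp o ψ⟫_ℂ) ↔
      ∀ x : {x : V // x ≠ o},
        ⟪w, N.dipole x o⟫_ℂ = ⟪f, N.lapOp o ⟨N.dipole x o, N.dipole_mem_DE o x⟩⟫_ℂ := by
    have h := Submodule.linearMap_eq_iff_of_eq_span
      (innerₛₗ ℂ w ∘ₗ (N.lapOp o).domain.subtype) (innerₛₗ ℂ f ∘ₗ (N.lapOp o).toFun)
      (show (N.lapOp o).domain = _ from rfl)
    exact LinearMap.ext_iff.symm.trans (h.trans Set.forall_subtype_range_iff)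
  have hdipole (x : {x : V // x ≠ o}) :
      ⟪w, N.dipole x o⟫_ℂ = ⟪f, N.lapOp o ⟨N.dipole x o, N.dipole_mem_DE o x⟩⟫_ℂ ↔
        N.drop x o w = N.lapHE f x - N.lapHE f o := by
    rw [← inner_dipole, ← inner_lapOp_dipole, ← inner_conj_symm w, ← inner_conj_symm f,
      (starRingEnd ℂ).injective.eq_iff]
  simp only [hspan, hdipole, Subtype.forall]
  refine ⟨fun h x => ?_, fun h x _ => h x⟩
  rcases eq_or_ne x o with rfl | hx
  · rw [drop_self, sub_self]
  · exact h x hx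

theorem mem_adjoint_lapOp_domain_iff (o : V) {f : N.HE} :
    f ∈ (N.lapOp o)†.domain ↔ N.lapHE f ∈ N.finiteEnergy := by
  simp only [mem_adjoint_domain_iff_exists (N.isNonnegSymmetric_lapOp o).dense,
    forall_inner_eq_inner_lapOp_iff, exists_forall_drop_eq_iff]

theorem mem_lapFri_domain_iff (o : V) {f : N.HE} :
    f ∈ (N.lapFri o).domain ↔ f ∈ formDomain (N.lapOp o) ∧ N.lapHE f ∈ N.finiteEnergy := by
  rw [lapFri, mem_friedrichs_domain_iff, mem_adjoint_lapOp_domain_iff]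

theorem inner_dipoleSum_lapOp_self (o : V) (ξ : {x : V // x ≠ o} →₀ ℂ) :
    ⟪(N.dipoleSum o ξ : N.HE), N.lapOp o (N.dipoleSum o ξ)⟫_ℂ =
      (((ξ.sum fun _ a => ‖a‖ ^ 2) + ‖ξ.sum fun _ a => a‖ ^ 2 : ℝ) : ℂ) := by
  simp only [inner_lapOp, Complex.conj_mul', Finsupp.sum]
  push_cast
  rfl

end Network

theorem lemma6p5 {V : Type*} [Countable V] (N : Network V) (o : V) :
    (∀ u : V → ℂ,
      (∃ hu : u ∈ N.finiteEnergy, N.toHE ⟨u, hu⟩ ∈ (N.lapFri o).domain) ↔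
        (∃ hu : u ∈ N.finiteEnergy, N.toHE ⟨u, hu⟩ ∈ formDomain (N.lapOp o)) ∧
          N.lap u ∈ N.finiteEnergy) ∧
    (∀ ξ : {x : V // x ≠ o} →₀ ℂ,
      inner ℂ (N.dipoleSum o ξ : N.HE) (N.lapOp o (N.dipoleSum o ξ)) =
        (((ξ.sum fun _ a => ‖a‖ ^ 2) + ‖ξ.sum fun _ a => a‖ ^ 2 : ℝ) : ℂ)) ∧
    (∀ ξ : {x : V // x ≠ o} →₀ ℂ, (ξ.sum fun _ a => a) = 0 →
      inner ℂ (N.dipoleSum o ξ : N.HE) (N.lapOp o (N.dipoleSum o ξ)) =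
        ((ξ.sum fun _ a => ‖a‖ ^ 2 : ℝ) : ℂ)) := by
  refine ⟨fun u => ?_, N.inner_dipoleSum_lapOp_self o, fun ξ hξ => ?_⟩
  · simp only [Network.mem_lapFri_domain_iff, Network.lapHE_toHE, exists_and_right]
  · rw [N.inner_dipoleSum_lapOp_self, hξ, norm_zero, zero_pow two_ne_zero, add_zero]
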